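/- Let $H, W_1, W_2$ be real Hilbert spaces, let $A:\mathcal D(A)\subset H\to H$ be a densely defined positive self-adjoint operator with compact inverse, and let $C:W_1\to H$ and $B:W_2\to H$ be bounded linear operators, $B\neq 0$; put $b=\|B\|>0$. Let $\bar\tau\ge 0$, let $\tau:[0,\infty)\to[0,\bar\tau]$ be continuous, and let $k\in L^1_{loc}([-\bar\tau,\infty);\mathbb R)$. Let $\psi:\mathcal D(A^{1/2})\to\mathbb R$ be Gâteaux differentiable and satisfy: (H1) for every $u\in\mathcal D(A^{1/2})$ there is $c(u)>0$ with $|D\psi(u)(v)|\le c(u)\|v\|_H$ for all $v\in \mathcal D(A^{1/2})$; $\nabla\psi(u)\in H$ denotes the unique vector with $D\psi(u)(v)=\langle\nabla\psi(u),v\rangle_H$ for all $v\in\mathcal D(A^{1/2})$; (H2) for every $r>0$ there is $L(r)>0$ with $\|\nabla\psi(u)-\nabla\psi(v)\|_H\le L(r)\|A^{1/2}(u-v)\|_H$ whenever $\|A^{1/2}u\|_H\le r$ and $\|A^{1/2}v\|_H\le r$; (H3) $\psi(0)=0$, $\nabla\psi(0)=0$, and there is a strictly increasing continuous function $h$ on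 $[0,\infty)$ with $\|\nabla\psi(u)\|_H\le h(\|A^{1/2}u\|_H)\,\|A^{1/2}u\|_H$ for all $u\in\mathcal D(A^{1/2})$. Let $u_0\in\mathcal D(A^{1/2})$, $u_1\in H$, $g\in C([-\bar\tau,0];W_2)$, and let $u$ be a solution on $[0,\infty)$ of $$u_{tt}(t)+Au(t)+CC^*u_t(t)+k(t)BB^*u_t(t-\tau(t))=\nabla\psi(u(t)),\quad t\ge0,$$ $$u(0)=u_0,\qquad u_t(0)=u_1,\qquad B^*u_t(s)=g(s)\ \text{ for } s\in[-\bar\tau,0],$$ that is, $u\in C([0,\infty);\mathcal D(A^{1/2}))\cap C^1([0,\infty);H)$ satisfies the initial conditions (in particular $B^*u_1=g(0)$, while for $s<0$ the symbol $B^*u_t(s)$ stands for $g(s)$), and for all $w\in\mathcal D(A)$ and $t\ge0$ $$\langle u_t(t),w\rangle=\langle u_1,w\rangle+\int_0^t\Big(\langle\nabla\psi(u(s)),w\rangle-\langle u(s),Aw\rangle-\langle CC^*u_t(s),w\rangle-k(s)\langle BB^*u_t(s-\tau(s)),w\rangle\Big)ds .$$ Define, for $t\ge 0$, $$E(t)=\tfrac12\|u_t(t)\|_H^2+\tfrac12\|A^{1/2}u(t)\|_H^2-\psi(u(t))+\tfrac12\int_{t-\bar\tau}^t|k(s)|\,\|B^*u_t(s)\|_{W_2}^2\,ds,$$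 $$\mathcal E(t)=\max\Big\{\tfrac14\max_{s\in[-\bar\tau,0]}\|g(s)\|_{W_2}^2,\ b^2\max_{s\in[0,t]}E(s)\Big\},$$ so that $\mathcal E(0)=\max\{\tfrac14\max_{s\in[-\bar\tau,0]}\|g(s)\|_{W_2}^2,\ b^2E(0)\}$. If $E(t)\ge\tfrac14\|u_t(t)\|_H^2$ for all $t\ge0$, then $$E(t)\le\frac1{b^2}\,e^{6b^2\int_0^t|k(s)|\,ds}\,\mathcal E(0)\qquad\text{for all } t\ge0 .$$ -/

import Mathlib

open Set MeasureTheory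
open scoped RealInnerProductSpace

noncomputable section

namespace DelayWave

variable {H : Type*} [NormedAddCommGroup H] [InnerProductSpace ℝ H] [CompleteSpace H]
variable {W₁ : Type*} [NormedAddCommGroup W₁] [InnerProductSpace ℝ W₁] [CompleteSpace W₁]
variable {W₂ : Type*} [NormedAddCommGroup W₂] [InnerProductSpace ℝ W₂] [CompleteSpace W₂]

/-- `A : D(A) ⊂ H → H` is a densely defined positive self-adjoint operator with compact inverse. -/
structure IsAdmissible (A : H →ₗ.[ℝ] H) : Prop where
  dense : Dense (A.domain : Set H)
  selfAdjoint : IsSelfAdjoint A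
  pos : ∀ x : A.domain, x ≠ 0 → 0 < ⟪A x, (x : H)⟫
  compact_inverse : ∃ T : H →L[ℝ] H, IsCompactOperator T ∧
    (∀ y : H, ∃ hy : T y ∈ A.domain, A ⟨T y, hy⟩ = y) ∧ ∀ x : A.domain, T (A x) = x

/-- The eigenspace `ker (A - l)` of an unbounded operator. -/
def eigenspace (A : H →ₗ.[ℝ] H) (l : ℝ) : Submodule ℝ H where
  carrier := {x | ∃ hx : x ∈ A.domain, A ⟨x, hx⟩ = l • x}
  zero_mem' := ⟨A.domain.zero_mem, by
    rw [smul_zero]; exact A.map_zero⟩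
  add_mem' := by
    rintro x y ⟨hx, ex⟩ ⟨hy, ey⟩
    refine ⟨A.domain.add_mem hx hy, ?_⟩
    rw [smul_add, ← ex, ← ey, ← A.map_add]
    rfl
  smul_mem' := by
    rintro c x ⟨hx, ex⟩
    refine ⟨A.domain.smul_mem c hx, ?_⟩
    rw [smul_comm, ← ex, ← A.map_smul]
    rfl

/-- The orthogonal projection onto `ker (A - l)`. (For self-adjoint `A` this eigenspace is
already closed; the closure only makes the definition meaningful for every `A`.) -/
def spectralProj (A : H →ₗ.[ℝ] H) (l : ℝ) : H →L[ℝ] H :=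
  (eigenspace A l).topologicalClosure.starProjection

/-- The square root `A^{1/2} = ∑ l^{1/2} P_l`, where `P_l` is the orthogonal projection onto
`ker (A - l)`, the sum being over all real `l` (only the eigenvalues of `A` contribute). Its
domain consists of the vectors `x` for which `∑ l^{1/2} P_l x` converges unconditionally in `H`;
as eigenspaces of a self-adjoint operator are orthogonal, this means `∑ l ‖P_l x‖² < ∞`. For a
positive self-adjoint operator with compact inverse, which has the spectral decomposition
`A = ∑ l P_l`, this is the positive self-adjoint square root. -/
def sqrtOp (A : H →ₗ.[ℝ] H) : H →ₗ.[ℝ] H where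
  domain :=
    { carrier := {x | Summable fun l : ℝ => √l • spectralProj A l x}
      zero_mem' := by
        simp only [mem_ofPred_eq, map_zero, smul_zero]
        exact summable_zero
      add_mem' := by
        intro x y hx hy
        simp only [mem_ofPred_eq, map_add, smul_add] at *
        exact hx.add hy
      smul_mem' := by
        intro c x hx
        simp only [mem_ofPred_eq, map_smul] at *
        simpa only [smul_comm c] using hx.const_smul c }
  toFun :=
    { toFun := fun x => ∑' l : ℝ, √l • spectralProj A l (x : H)
      map_add' := by
        intro x y
        simp only [Submodule.coe_add, map_add, smul_add]
        exact x.2.tsum_add y.2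
      map_smul' := by
        intro c x
        simp only [Submodule.coe_smul, map_smul, RingHom.id_apply]
        simp only [smul_comm _ c]
        exact x.2.tsum_const_smul c }

/-- The energy space `D(A^{1/2})`. -/
abbrev EnergyDom (A : H →ₗ.[ℝ] H) : Type _ := (sqrtOp A).domain

/-- Assumptions on the nonlinear potential `ψ : D(A^{1/2}) → ℝ` and its gradient `∇ψ`. -/
structure IsPotential (A : H →ₗ.[ℝ] H) (ψ : EnergyDom A → ℝ) (gradψ : EnergyDom A → H) :
    Prop where
  /-- `ψ` is Gâteaux differentiable, each `Dψ(u)` is bounded for the norm of `H`, and `∇ψ(u)` is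
  its Riesz representative in `H` (unique, since `D(A^{1/2})` is dense). -/
  gateaux : ∀ u v : EnergyDom A, HasLineDerivAt ℝ ψ ⟪gradψ u, (v : H)⟫ u v
  locallyLipschitz : ∀ r : ℝ, 0 < r → ∃ L : ℝ, 0 < L ∧ ∀ u v : EnergyDom A,
    ‖sqrtOp A u‖ ≤ r → ‖sqrtOp A v‖ ≤ r → ‖gradψ u - gradψ v‖ ≤ L * ‖sqrtOp A (u - v)‖
  map_zero : ψ 0 = 0
  grad_zero : gradψ 0 = 0
  growth : ∃ h : ℝ → ℝ, StrictMonoOn h (Ici 0) ∧ ContinuousOn h (Ici 0) ∧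
    ∀ u : EnergyDom A, ‖gradψ u‖ ≤ h ‖sqrtOp A u‖ * ‖sqrtOp A u‖

/-- The function `s ↦ B* u_t(s)` on `[-τ̄, ∞)`: it is `g` at negative times. Here `v = u_t`. -/
def observation (B : W₂ →L[ℝ] H) (g : ℝ → W₂) (v : ℝ → H) (s : ℝ) : W₂ :=
  if s < 0 then g s else B.adjoint (v s)

/-- `u`, with velocity `v = u_t`, is a (weak, equivalently mild) solution on `[0, ∞)` of
`u_tt + A u + C C* u_t + k(t) B B* u_t(t - τ(t)) = ∇ψ(u)`, `u(0) = u₀`, `u_t(0) = u₁`,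
`B* u_t = g` on `[-τ̄, 0]`, in the class `C([0,∞); D(A^{1/2})) ∩ C¹([0,∞); H)`. The equation is
tested against the vectors of `D(A)` and integrated in time. Only the values of `u`, `v` at times
`t ≥ 0` are relevant. -/
structure IsSolution (A : H →ₗ.[ℝ] H) (C : W₁ →L[ℝ] H) (B : W₂ →L[ℝ] H) (k τ : ℝ → ℝ)
    (gradψ : EnergyDom A → H) (u₀ : EnergyDom A) (u₁ : H) (g : ℝ → W₂)
    (u : ℝ → EnergyDom A) (v : ℝ → H) : Prop where
  hasDeriv : ∀ t : ℝ, 0 ≤ t → HasDerivWithinAt (fun s => (u s : H)) (v t) (Ici 0) t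
  continuousOn_velocity : ContinuousOn v (Ici 0)
  continuousOn_sqrt : ContinuousOn (fun t => sqrtOp A (u t)) (Ici 0)
  initial_position : u 0 = u₀
  initial_velocity : v 0 = u₁
  /-- `B* u_t(0) = g(0)`; the condition at negative times is built into `observation`. -/
  history : B.adjoint (v 0) = g 0
  equation : ∀ w : A.domain, ∀ t : ℝ, 0 ≤ t →
    ⟪v t, (w : H)⟫ = ⟪u₁, (w : H)⟫ + ∫ s in (0 : ℝ)..t,
      (⟪gradψ (u s), (w : H)⟫ - ⟪(u s : H), A w⟫ - ⟪C (C.adjoint (v s)), (w : H)⟫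
        - k s * ⟪B (observation B g v (s - τ s)), (w : H)⟫)

/-- The energy
`E(t) = ½‖u_t‖² + ½‖A^{1/2}u‖² - ψ(u) + ½ ∫_{t-τ̄}^t |k(s)| ‖B* u_t(s)‖² ds`. -/
def energy (A : H →ₗ.[ℝ] H) (B : W₂ →L[ℝ] H) (k : ℝ → ℝ) (τbar : ℝ) (ψ : EnergyDom A → ℝ)
    (g : ℝ → W₂) (u : ℝ → EnergyDom A) (v : ℝ → H) (t : ℝ) : ℝ :=
  1 / 2 * ‖v t‖ ^ 2 + 1 / 2 * ‖sqrtOp A (u t)‖ ^ 2 - ψ (u t)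
    + 1 / 2 * ∫ s in (t - τbar)..t, |k s| * ‖observation B g v s‖ ^ 2

/-- `𝓔(t) = max {¼ max_{[-τ̄,0]} ‖g‖², b² max_{[0,t]} E}` with `b = ‖B‖`. -/
def energySup (A : H →ₗ.[ℝ] H) (B : W₂ →L[ℝ] H) (k : ℝ → ℝ) (τbar : ℝ) (ψ : EnergyDom A → ℝ)
    (g : ℝ → W₂) (u : ℝ → EnergyDom A) (v : ℝ → H) (t : ℝ) : ℝ :=
  max (1 / 4 * sSup ((fun s => ‖g s‖ ^ 2) '' Icc (-τbar) 0))
    (‖B‖ ^ 2 * sSup (energy A B k τbar ψ g u v '' Icc 0 t))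

end DelayWave

end

/-! The bound is a Gronwall argument for `b² E`, fed by an energy inequality. A weak solution is not
regular enough to be paired with `u_t` directly, so the equation is tested against an eigenbasis of
`A`, which exists because `A` has compact inverse. Each mode is a scalar forced oscillator with
absolutely continuous velocity and an exact energy identity; Parseval and dominated convergence sum
these (`linear_energy_identity`). The potential term is integrated by a chain rule for `ψ ∘ u`,
although `u` is differentiable only in `H` (`IsPotential.hasDerivWithinAt_comp`).

Dropping the damping and using Young's inequality on the delay term leaves `E(T) - E(0) ≤ ∫ |k|
(½‖o(s-τ)‖² + ‖o(s)‖²)`, where `o` is the observation (`IsSolution.energy_sub_le`). Since `E ≥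
¼‖u_t‖²`, one has `‖o‖² ≤ 4 b² E` at nonnegative times, while `𝓔(0)` controls the history. The
comparison function `N exp(6 b² ∫|k|)` is nondecreasing, so a bound on `[0,s]` also covers the
delayed time `s - τ(s)`. The constant is `½·4 + 4 = 6`, and `gronwall_of_continuation` concludes. -/

namespace DelayWave

/-! ### Eigenbasis of `A` and the action of `A^{1/2}` on it -/

section Spectral

universe u

variable {H : Type u} [NormedAddCommGroup H] [InnerProductSpace ℝ H]


theorem IsAdmissible.inner_symm [CompleteSpace H] {A : H →ₗ.[ℝ] H} (hA : IsAdmissible A) (x y : A.domain) :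
    ⟪A x, (y : H)⟫ = ⟪(x : H), A y⟫ := by
  have h := LinearPMap.adjoint_isFormalAdjoint hA.dense
  rw [LinearPMap.isSelfAdjoint_def.1 hA.selfAdjoint] at h
  exact h x y

theorem isSeparable_range_of_isCompactOperator {T : H →L[ℝ] H} (hT : IsCompactOperator T) :
    TopologicalSpace.IsSeparable (range T) := by
  have h : range T ⊆ ⋃ n : ℕ, closure (T '' Metric.closedBall 0 n) := by
    rintro _ ⟨x, rfl⟩
    obtain ⟨n, hn⟩ := exists_nat_ge ‖x‖
    exact mem_iUnion.2 ⟨n, subset_closure ⟨x, by simpa using hn, rfl⟩⟩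
  refine TopologicalSpace.IsSeparable.mono ?_ h
  exact TopologicalSpace.isSeparable_iUnion.2 fun n =>
    (hT.isCompact_closure_image_closedBall (n : ℝ)).isSeparable

/-- The range of the compact inverse is separable and contains the dense domain of `A`. Separability
makes the eigenbasis countable, as dominated convergence along finite subsets requires. -/
theorem IsAdmissible.separableSpace [CompleteSpace H] {A : H →ₗ.[ℝ] H} (hA : IsAdmissible A) :
    TopologicalSpace.SeparableSpace H := by
  obtain ⟨T, hT, -, hTA⟩ := hA.compact_inverse
  have h := (isSeparable_range_of_isCompactOperator hT).closure
  have hd : closure (range T) = univ :=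
    (hA.dense.mono (s₂ := range T) fun x hx => ⟨A ⟨x, hx⟩, hTA ⟨x, hx⟩⟩).closure_eq
  rw [hd] at h
  exact TopologicalSpace.isSeparable_univ_iff.1 h

theorem countable_of_orthonormal [TopologicalSpace.SeparableSpace H] {ι : Type*} {e : ι → H}
    (he : Orthonormal ℝ e) : Countable ι := by
  -- Distinct orthonormal vectors are at distance `√2 > 1`.
  have hd : (univ : Set ι).PairwiseDisjoint fun i => Metric.ball (e i) (1 / 2) := by
    intro i _ j _ hij
    refine Metric.ball_disjoint_ball ?_
    have h : ‖e i - e j‖ ^ 2 = 2 := by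
      rw [norm_sub_sq_real, he.1 i, he.1 j, he.2 hij]; norm_num
    rw [dist_eq_norm]
    nlinarith [norm_nonneg (e i - e j)]
  exact countable_univ_iff.1 (hd.countable_of_isOpen (fun _ _ => Metric.isOpen_ball)
    fun i _ => ⟨e i, Metric.mem_ball_self (by norm_num)⟩)

variable [CompleteSpace H]

/-- Hilbert bases of the mutually orthogonal eigenspaces are glued; the result is total because the
eigenspaces of a compact symmetric operator are. -/
theorem exists_hilbertBasis_of_isCompactOperator {T : H →L[ℝ] H} (hT : IsCompactOperator T)
    (hT' : (T : H →ₗ[ℝ] H).IsSymmetric) :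
    ∃ (ι : Type u) (e : HilbertBasis ι ℝ H) (μ : ι → ℝ), ∀ i, T (e i) = μ i • e i := by
  let V : ℝ → Submodule ℝ H := fun μ => Module.End.eigenspace (T : Module.End ℝ H) μ
  have hcl (μ : ℝ) : IsClosed (V μ : Set H) := by
    have : (V μ : Set H) = {x | T x = μ • x} := by
      ext x; exact Module.End.mem_eigenspace_iff
    rw [this]
    exact isClosed_eq T.continuous (continuous_const_smul μ)
  have hcomp (μ : ℝ) : CompleteSpace (V μ) := (hcl μ).completeSpace_coe
  choose w b hb using fun μ => exists_hilbertBasis ℝ (V μ)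
  have hon : Orthonormal ℝ fun a : Σ μ, w μ => (V a.1).subtypeₗᵢ (b a.1 a.2) :=
    hT'.orthogonalFamily_eigenspaces.orthonormal_sigma_orthonormal fun μ => (b μ).orthonormal
  have hbot : (Submodule.span ℝ
      (range fun a : Σ μ, w μ => (V a.1).subtypeₗᵢ (b a.1 a.2)))ᗮ = ⊥ := by
    rw [eq_bot_iff, ← ContinuousLinearMap.orthogonalComplement_iSup_eigenspaces_eq_bot hT hT']
    intro x hx
    rw [← Submodule.iInf_orthogonal, Submodule.mem_iInf]
    intro μ
    -- A continuous functional vanishing on a Hilbert basis of the eigenspace vanishes on all of it.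
    have h0 : (innerSL ℝ x).comp (V μ).subtypeL = 0 := by
      refine ContinuousLinearMap.ext_on (s := range (b μ)) ?_ ?_
      · exact (Submodule.dense_iff_topologicalClosure_eq_top).2 (b μ).dense_span
      · rintro _ ⟨a, rfl⟩
        have := (Submodule.mem_orthogonal' _ _).1 hx ((b μ a : V μ) : H)
          (Submodule.subset_span ⟨⟨μ, a⟩, rfl⟩)
        simpa using this
    refine (Submodule.mem_orthogonal' _ _).2 fun y hy => ?_
    exact congrArg (fun f => f ⟨y, hy⟩) h0
  refine ⟨_, HilbertBasis.mkOfOrthogonalEqBot hon hbot, fun a => a.1, fun a => ?_⟩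
  rw [HilbertBasis.coe_mkOfOrthogonalEqBot]
  exact Module.End.mem_eigenspace_iff.1 (b a.1 a.2).2

theorem IsAdmissible.exists_hilbertBasis {A : H →ₗ.[ℝ] H} (hA : IsAdmissible A) :
    ∃ (ι : Type u) (_ : Countable ι) (e : HilbertBasis ι ℝ H) (l : ι → ℝ),
      ∀ i, 0 < l i ∧ e i ∈ eigenspace A (l i) := by
  obtain ⟨T, hT, hAT, hTA⟩ := hA.compact_inverse
  have hsymm : (T : H →ₗ[ℝ] H).IsSymmetric := by
    intro x y
    obtain ⟨hx, ex⟩ := hAT x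
    obtain ⟨hy, ey⟩ := hAT y
    have h := hA.inner_symm ⟨T x, hx⟩ ⟨T y, hy⟩
    rw [ex, ey] at h
    exact h.symm
  obtain ⟨ι, e, μ, he⟩ := exists_hilbertBasis_of_isCompactOperator hT hsymm
  have := hA.separableSpace
  refine ⟨ι, countable_of_orthonormal e.orthonormal, e, fun i => (μ i)⁻¹, fun i => ?_⟩
  have hne : e i ≠ 0 := e.orthonormal.ne_zero i
  obtain ⟨hx, ex⟩ := hAT (e i)
  have hμ : μ i ≠ 0 := by
    intro h0
    have h1 : T (e i) = 0 := by rw [he, h0, zero_smul]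
    have h2 : (⟨T (e i), hx⟩ : A.domain) = 0 := Subtype.ext h1
    rw [h2, A.map_zero] at ex
    exact hne ex.symm
  have hmem : e i ∈ A.domain := by
    have h := A.domain.smul_mem (μ i)⁻¹ hx
    rwa [he, smul_smul, inv_mul_cancel₀ hμ, one_smul] at h
  have heig : A ⟨e i, hmem⟩ = (μ i)⁻¹ • e i := by
    have h : (⟨T (e i), hx⟩ : A.domain) = μ i • ⟨e i, hmem⟩ := Subtype.ext (he i)
    rw [h, A.map_smul] at ex
    exact (eq_inv_smul_iff₀ hμ).2 ex
  refine ⟨?_, hmem, heig⟩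
  have h := hA.pos ⟨e i, hmem⟩ fun h => hne (congrArg Subtype.val h)
  rw [heig, real_inner_smul_left, real_inner_self_eq_norm_sq, e.orthonormal.1 i] at h
  simpa using h

theorem IsAdmissible.spectralProj_apply_eigenvector {A : H →ₗ.[ℝ] H} (hA : IsAdmissible A)
    {l m : ℝ} {x : H} (hx : x ∈ eigenspace A m) :
    spectralProj A l x = if l = m then x else 0 := by
  unfold spectralProj
  split_ifs with h
  · subst h
    exact Submodule.starProjection_eq_self_iff.2 (Submodule.le_topologicalClosure _ hx)
  · refine (Submodule.starProjection_apply_eq_zero_iff _).2 ?_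
    rw [Submodule.orthogonal_closure, Submodule.mem_orthogonal]
    rintro y ⟨hy, ey⟩
    obtain ⟨hx, ex⟩ := hx
    have hs := hA.inner_symm ⟨y, hy⟩ ⟨x, hx⟩
    rw [ey, ex, real_inner_smul_left, real_inner_smul_right] at hs
    exact (mul_eq_zero.1 (by linarith : (l - m) * ⟪y, x⟫ = 0)).resolve_left (sub_ne_zero.2 h)

/-- Pairing the series that defines `A^{1/2} u` with an eigenvector leaves only the term `l = m`.
This gives the Fourier coefficients of `A^{1/2} u`. -/
theorem IsAdmissible.inner_sqrtOp_eigenvector {A : H →ₗ.[ℝ] H} (hA : IsAdmissible A)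
    {m : ℝ} {x : H} (hx : x ∈ eigenspace A m) (u : EnergyDom A) :
    ⟪x, sqrtOp A u⟫ = √m * ⟪x, (u : H)⟫ := by
  have hs : Summable fun l : ℝ => √l • spectralProj A l (u : H) := u.2
  have h := (innerSL ℝ x).hasSum hs.hasSum
  have h2 : HasSum (fun l : ℝ => ⟪x, √l • spectralProj A l (u : H)⟫) (√m * ⟪x, (u : H)⟫) := by
    convert hasSum_single m ?_ using 1
    · rw [real_inner_smul_right]
      unfold spectralProj
      rw [← Submodule.inner_starProjection_left_eq_right]
      change _ = √m * ⟪spectralProj A m x, _⟫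
      rw [hA.spectralProj_apply_eigenvector hx, if_pos rfl]
    · intro l hl
      rw [real_inner_smul_right]
      unfold spectralProj
      rw [← Submodule.inner_starProjection_left_eq_right]
      change √l * ⟪spectralProj A l x, _⟫ = 0
      rw [hA.spectralProj_apply_eigenvector hx, if_neg hl, inner_zero_left, mul_zero]
  exact h.unique h2

end Spectral

/-! ### Absolutely continuous calculus, oscillators and Gronwall -/

section ScalarCalculus

open Filter Topology

/-- `F` is bounded on the interval, and the `C¹` function `φ` is Lipschitz on a compact interval
containing its values. -/
theorem absolutelyContinuousOnInterval_comp {φ F : ℝ → ℝ} {a b : ℝ} (hφ : ContDiff ℝ 1 φ)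
    (hF : AbsolutelyContinuousOnInterval F a b) :
    AbsolutelyContinuousOnInterval (fun x => φ (F x)) a b := by
  obtain ⟨M, hM⟩ := hF.exists_bound
  obtain ⟨K, hK⟩ := (isCompact_Icc (a := -M) (b := M)).exists_bound_of_continuousOn
    (hφ.continuous_deriv le_rfl).continuousOn
  have hlip : ∀ x ∈ Icc (-M) M, ∀ y ∈ Icc (-M) M, dist (φ x) (φ y) ≤ |K| * dist x y := by
    intro x hx y hy
    rw [dist_comm (φ x), dist_comm x, dist_eq_norm, dist_eq_norm]
    exact (convex_Icc (-M) M).norm_image_sub_le_of_norm_deriv_le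
      (fun z _ => (hφ.differentiable one_ne_zero).differentiableAt)
      (fun z hz => (hK z hz).trans (le_abs_self K)) hx hy
  rw [absolutelyContinuousOnInterval_iff] at hF ⊢
  intro ε hε
  obtain ⟨δ, hδ, h⟩ := hF (ε / (|K| + 1)) (by positivity)
  refine ⟨δ, hδ, fun E hE hEδ => ?_⟩
  have h1 : ∑ i ∈ Finset.range E.1, dist (φ (F (E.2 i).1)) (φ (F (E.2 i).2)) ≤
      |K| * ∑ i ∈ Finset.range E.1, dist (F (E.2 i).1) (F (E.2 i).2) := by
    rw [Finset.mul_sum]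
    refine Finset.sum_le_sum fun i hi => ?_
    have hm := hE.1 i hi
    exact hlip _ (abs_le.1 (hM _ hm.1)) _ (abs_le.1 (hM _ hm.2))
  have h2 := h E hE hEδ
  rw [lt_div_iff₀ (by positivity)] at h2
  have h3 : 0 ≤ ∑ i ∈ Finset.range E.1, dist (F (E.2 i).1) (F (E.2 i).2) :=
    Finset.sum_nonneg fun _ _ => dist_nonneg
  nlinarith

/-- The fundamental theorem of calculus for `φ ∘ F`, where `F` is a primitive of an integrable
function. -/
theorem integral_deriv_comp_primitive {φ F f : ℝ → ℝ} {c T : ℝ} (hφ : ContDiff ℝ 1 φ)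
    (hT : 0 ≤ T) (hf : IntervalIntegrable f volume 0 T)
    (hF : ∀ t ∈ Icc 0 T, F t = c + ∫ s in (0 : ℝ)..t, f s) :
    φ (F T) - φ c = ∫ s in (0 : ℝ)..T, deriv φ (F s) * f s := by
  -- `F` is arbitrary outside `[0, T]`, so derivatives are taken of the global primitive `G`.
  let G : ℝ → ℝ := fun t => c + ∫ s in (0 : ℝ)..t, f s
  have hG : AbsolutelyContinuousOnInterval G 0 T := by
    have h1 : AbsolutelyContinuousOnInterval (fun _ : ℝ => c) 0 T :=
      (LipschitzWith.const c).lipschitzOnWith.absolutelyContinuousOnInterval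
    exact h1.add (hf.absolutelyContinuousOnInterval_intervalIntegral (c := 0) left_mem_uIcc)
  have h := (absolutelyContinuousOnInterval_comp hφ hG).integral_deriv_eq_sub
  have hG0 : G 0 = c := by simp [G]
  have hGT : F T = G T := hF T ⟨hT, le_rfl⟩
  rw [hGT, ← hG0, ← h]
  refine intervalIntegral.integral_congr_ae ?_
  filter_upwards [hf.ae_hasDerivAt_integral] with x hx hxT
  have hxI : x ∈ uIcc 0 T := uIoc_subset_uIcc hxT
  have hd : HasDerivAt G (f x) x := (hx hxI 0 left_mem_uIcc).const_add c
  have hGx : F x = G x := hF x (by rwa [uIcc_of_le hT] at hxI)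
  rw [hGx]
  exact (((hφ.differentiable one_ne_zero) (G x)).hasDerivAt.comp x hd).deriv

/-- Energy identity for a forced harmonic oscillator. -/
theorem oscillator_energy {p q f : ℝ → ℝ} {l T : ℝ} (hT : 0 ≤ T)
    (hf : IntervalIntegrable f volume 0 T) (hq : ContinuousOn q (Icc 0 T))
    (hp : ∀ t ∈ Icc 0 T, HasDerivWithinAt p (q t) (Icc 0 T) t)
    (heq : ∀ t ∈ Icc 0 T, q t = q 0 + ∫ s in (0 : ℝ)..t, (f s - l * p s)) :
    q T ^ 2 + l * p T ^ 2 - (q 0 ^ 2 + l * p 0 ^ 2) = 2 * ∫ s in (0 : ℝ)..T, f s * q s := by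
  have hpc : ContinuousOn p (Icc 0 T) := fun t ht => (hp t ht).continuousWithinAt
  rw [← uIcc_of_le hT] at hq hpc
  have hd : ∀ t, deriv (fun x : ℝ => x ^ 2) t = 2 * t := fun t => by simp
  have h1 := integral_deriv_comp_primitive (φ := fun x => x ^ 2) (by fun_prop) hT
    (hf.sub (hpc.intervalIntegrable.const_mul l)) heq
  have hprim : ∀ t ∈ Icc 0 T, p t = p 0 + ∫ s in (0 : ℝ)..t, q s := by
    intro t ht
    have hsub : Icc 0 t ⊆ Icc 0 T := Icc_subset_Icc_right ht.2
    rw [intervalIntegral.integral_eq_sub_of_hasDerivAt_of_le ht.1 (f := p)]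
    · ring
    · exact (uIcc_of_le hT ▸ hpc).mono hsub
    · intro x hx
      exact (hp x (hsub (Ioo_subset_Icc_self hx))).hasDerivAt
        (Icc_mem_nhds hx.1 (hx.2.trans_le ht.2))
    · exact (hq.mono (by rwa [uIcc_of_le ht.1, uIcc_of_le hT])).intervalIntegrable
  have h2 := integral_deriv_comp_primitive (φ := fun x => x ^ 2) (by fun_prop) hT
    hq.intervalIntegrable hprim
  simp only [hd] at h1 h2
  have hi1 : IntervalIntegrable (fun s => f s * q s) volume 0 T := hf.mul_continuousOn hq
  have hi2 : IntervalIntegrable (fun s => p s * q s) volume 0 T :=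
    (hpc.mul hq).intervalIntegrable
  have e1 : ∫ s in (0 : ℝ)..T, 2 * q s * (f s - l * p s) =
      2 * (∫ s in (0 : ℝ)..T, f s * q s) - 2 * l * ∫ s in (0 : ℝ)..T, p s * q s := by
    rw [← intervalIntegral.integral_const_mul, ← intervalIntegral.integral_const_mul,
      ← intervalIntegral.integral_sub (hi1.const_mul 2) (hi2.const_mul (2 * l))]
    congr 1; ext s; ring
  have e2 : ∫ s in (0 : ℝ)..T, 2 * p s * q s = 2 * ∫ s in (0 : ℝ)..T, p s * q s := by
    rw [← intervalIntegral.integral_const_mul]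
    congr 1; ext s; ring
  rw [e1] at h1
  rw [e2] at h2
  -- The weight `l` cancels the cross terms `∫ p q`.
  linear_combination h1 + l * h2

/-- A Gronwall inequality with integrable kernel: the growth of `y` is only required to be
controlled on intervals where `y` stays below the claimed bound. -/
theorem gronwall_of_continuation {y κ : ℝ → ℝ} {M T : ℝ} (hT : 0 ≤ T)
    (hκ : IntervalIntegrable κ volume 0 T)
    (hy : ContinuousOn y (Icc 0 T)) (hy0 : y 0 ≤ M)
    (hstep : ∀ N : ℝ, M ≤ N → ∀ t ∈ Icc 0 T,
      (∀ s ∈ Icc 0 t, y s ≤ N * Real.exp (∫ r in (0 : ℝ)..s, κ r)) →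
      y t - y 0 ≤ ∫ s in (0 : ℝ)..t, κ s * (N * Real.exp (∫ r in (0 : ℝ)..s, κ r))) :
    y T ≤ M * Real.exp (∫ r in (0 : ℝ)..T, κ r) := by
  set K : ℝ → ℝ := fun t => ∫ r in (0 : ℝ)..t, κ r with hK
  have hKc : ContinuousOn K (Icc 0 T) := by
    have := intervalIntegral.continuousOn_primitive_interval (μ := volume) (f := κ)
      (a := 0) (b := T)
      (by rw [uIcc_of_le hT]; exact (intervalIntegrable_iff_integrableOn_Icc_of_le hT).1 hκ)
    rwa [uIcc_of_le hT] at this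
  -- The slack `N > M` makes the inequality strict at the first contact time; `N` tends to `M` at
  -- the end.
  have hstrict : ∀ N, M < N → ∀ t ∈ Icc 0 T, y t < N * Real.exp (K t) := by
    intro N hN
    by_contra! hcon
    obtain ⟨t₁, ht₁, hbad⟩ := hcon
    let S := {t ∈ Icc 0 T | N * Real.exp (K t) ≤ y t}
    have hexpc : ContinuousOn (fun t => N * Real.exp (K t)) (Icc 0 T) :=
      continuousOn_const.mul (Real.continuous_exp.comp_continuousOn hKc)
    have hScl : IsClosed S := isClosed_Icc.isClosed_le hexpc hy
    have hSc : IsCompact S := isCompact_Icc.of_isClosed_subset hScl fun t ht => ht.1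
    obtain ⟨t, ht, hmin⟩ := hSc.exists_isLeast ⟨t₁, ht₁, hbad⟩
    have hIκ : IntervalIntegrable κ volume 0 t :=
      hκ.mono_set (by rw [uIcc_of_le ht.1.1, uIcc_of_le hT]; exact Icc_subset_Icc_right ht.1.2)
    have hbelow : ∀ s ∈ Ico 0 t, y s ≤ N * Real.exp (K s) := by
      intro s hs
      by_contra! h
      exact absurd (hmin ⟨⟨hs.1, hs.2.le.trans ht.1.2⟩, h.le⟩) (not_le.2 hs.2)
    have ht0 : 0 < t := by
      rcases ht.1.1.eq_or_lt with h | h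
      · have := ht.2
        rw [← h] at this
        simp only [hK, intervalIntegral.integral_same, Real.exp_zero, mul_one] at this
        linarith
      · exact h
    have hsub : Icc 0 t ⊆ Icc 0 T := Icc_subset_Icc_right ht.1.2
    have hle : ∀ s ∈ Icc 0 t, y s ≤ N * Real.exp (K s) := by
      have hcl : closure (Ico 0 t) = Icc 0 t := closure_Ico ht0.ne
      intro s hs
      have h := hcl ▸ hs
      refine ContinuousWithinAt.closure_le h ?_ ?_ hbelow
      · exact (hy s (hsub hs)).mono (Ico_subset_Icc_self.trans hsub)
      · exact (hexpc s (hsub hs)).mono (Ico_subset_Icc_self.trans hsub)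
    have hst := hstep N hN.le t ht.1 hle
    have hexp := integral_deriv_comp_primitive (φ := Real.exp) (F := K) (c := 0)
      Real.contDiff_exp ht.1.1 hIκ (fun s _ => by simp [hK])
    rw [Real.deriv_exp, Real.exp_zero] at hexp
    -- At the first contact this gives `y t ≤ y 0 + N exp(K t) - N < N exp(K t)`, a contradiction.
    have he : ∫ s in (0 : ℝ)..t, κ s * (N * Real.exp (K s)) = N * (Real.exp (K t) - 1) := by
      rw [hexp, ← intervalIntegral.integral_const_mul]
      congr 1; ext s; ring
    rw [he] at hst
    linarith [ht.2]
  refine le_of_forall_pos_le_add fun ε hε => ?_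
  have hpos := Real.exp_pos (K T)
  have h := hstrict (M + ε / Real.exp (K T)) (by linarith [div_pos hε hpos]) T ⟨hT, le_rfl⟩
  rw [add_mul, div_mul_cancel₀ _ hpos.ne'] at h
  exact h.le

end ScalarCalculus

/-! ### Energy identity for the linear equation with forcing -/

section EnergyIdentity

open Filter Topology

universe u

variable {H : Type u} [NormedAddCommGroup H] [InnerProductSpace ℝ H]

/-- Cauchy–Schwarz and Bessel. Uniformity in `F` provides the dominating function for the Parseval
sums. -/
theorem abs_sum_inner_mul_inner_le {ι : Type*} {e : ι → H} (he : Orthonormal ℝ e)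
    (F : Finset ι) (x y : H) :
    |∑ i ∈ F, ⟪x, e i⟫ * ⟪e i, y⟫| ≤ ‖x‖ * ‖y‖ := by
  have hb : ∀ z : H, ∑ i ∈ F, ⟪e i, z⟫ ^ 2 ≤ ‖z‖ ^ 2 := fun z => by
    simpa using he.sum_inner_products_le (s := F) z
  refine abs_le_of_sq_le_sq ?_ (by positivity)
  calc (∑ i ∈ F, ⟪x, e i⟫ * ⟪e i, y⟫) ^ 2
      ≤ (∑ i ∈ F, ⟪x, e i⟫ ^ 2) * ∑ i ∈ F, ⟪e i, y⟫ ^ 2 :=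
        Finset.sum_mul_sq_le_sq_mul_sq F _ _
    _ ≤ ‖x‖ ^ 2 * ‖y‖ ^ 2 := by
        have hx : ∀ i, ⟪x, e i⟫ = ⟪e i, x⟫ := fun i => real_inner_comm _ _
        simp only [hx]
        exact mul_le_mul (hb x) (hb y) (Finset.sum_nonneg fun _ _ => sq_nonneg _) (sq_nonneg _)
    _ = (‖x‖ * ‖y‖) ^ 2 := by ring

theorem hasSum_integral_inner_mul_inner {ι : Type*} [Countable ι] (e : HilbertBasis ι ℝ H)
    {f v : ℝ → H} {T : ℝ} (hf : IntervalIntegrable f volume 0 T)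
    (hv : ContinuousOn v (uIcc 0 T)) :
    HasSum (fun i => ∫ s in (0 : ℝ)..T, ⟪f s, e i⟫ * ⟪e i, v s⟫)
      (∫ s in (0 : ℝ)..T, ⟪f s, v s⟫) := by
  have hfi : ∀ i, IntervalIntegrable (fun s => ⟪f s, e i⟫ * ⟪e i, v s⟫) volume 0 T := fun i =>
    IntervalIntegrable.mul_continuousOn
      ⟨hf.1.inner_const (e i), hf.2.inner_const (e i)⟩ (continuousOn_const.inner hv)
  have hlim : Tendsto (fun F : Finset ι => ∫ s in (0 : ℝ)..T, ∑ i ∈ F, ⟪f s, e i⟫ * ⟪e i, v s⟫)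
      atTop (𝓝 (∫ s in (0 : ℝ)..T, ⟪f s, v s⟫)) := by
    refine intervalIntegral.tendsto_integral_filter_of_dominated_convergence
      (fun s => ‖f s‖ * ‖v s‖) ?_ ?_ (hf.norm.mul_continuousOn hv.norm) ?_
    · refine Eventually.of_forall fun F => ?_
      exact Finset.aestronglyMeasurable_fun_sum F fun i _ =>
        (intervalIntegrable_iff.1 (hfi i)).aestronglyMeasurable
    · exact Eventually.of_forall fun F => Eventually.of_forall fun s _ =>
        abs_sum_inner_mul_inner_le e.orthonormal F _ _
    · exact Eventually.of_forall fun s _ => e.hasSum_inner_mul_inner (f s) (v s)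
  refine hlim.congr fun F => ?_
  exact intervalIntegral.integral_finsetSum fun i _ => hfi i

/-- Testing with `e i` turns the equation into an oscillator of squared frequency `l i`; the modal
energies sum to the full energy by Parseval. -/
theorem linear_energy_identity [CompleteSpace H] {A : H →ₗ.[ℝ] H} (hA : IsAdmissible A) {u : ℝ → EnergyDom A}
    {v f : ℝ → H} {T : ℝ} (hT : 0 ≤ T) (hf : IntervalIntegrable f volume 0 T)
    (hv : ContinuousOn v (Icc 0 T))
    (hu : ∀ t ∈ Icc 0 T, HasDerivWithinAt (fun s => (u s : H)) (v t) (Icc 0 T) t)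
    (heq : ∀ w : A.domain, ∀ t ∈ Icc 0 T, ⟪v t, (w : H)⟫ = ⟪v 0, (w : H)⟫ +
      ∫ s in (0 : ℝ)..t, (⟪f s, (w : H)⟫ - ⟪(u s : H), A w⟫)) :
    ‖v T‖ ^ 2 + ‖sqrtOp A (u T)‖ ^ 2 - (‖v 0‖ ^ 2 + ‖sqrtOp A (u 0)‖ ^ 2) =
      2 * ∫ s in (0 : ℝ)..T, ⟪f s, v s⟫ := by
  obtain ⟨ι, _, e, l, he⟩ := hA.exists_hilbertBasis
  have hsum : ∀ t, HasSum (fun i => ⟪e i, v t⟫ ^ 2 + l i * ⟪e i, (u t : H)⟫ ^ 2)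
      (‖v t‖ ^ 2 + ‖sqrtOp A (u t)‖ ^ 2) := by
    intro t
    have h1 := e.hasSum_inner_mul_inner (v t) (v t)
    have h2 := e.hasSum_inner_mul_inner (sqrtOp A (u t)) (sqrtOp A (u t))
    rw [real_inner_self_eq_norm_sq] at h1 h2
    refine (h1.add h2).congr_fun ?_
    intro i
    rw [real_inner_comm (e i) (v t), real_inner_comm (e i) (sqrtOp A (u t)),
      hA.inner_sqrtOp_eigenvector (he i).2]
    have := Real.sq_sqrt (he i).1.le
    linear_combination (-⟪e i, (u t : H)⟫ ^ 2) * this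
  have hcoord : ∀ i, ⟪e i, v T⟫ ^ 2 + l i * ⟪e i, (u T : H)⟫ ^ 2 -
      (⟪e i, v 0⟫ ^ 2 + l i * ⟪e i, (u 0 : H)⟫ ^ 2) =
      2 * ∫ s in (0 : ℝ)..T, ⟪f s, e i⟫ * ⟪e i, v s⟫ := by
    intro i
    refine oscillator_energy (p := fun t => ⟪e i, (u t : H)⟫) (q := fun t => ⟪e i, v t⟫)
      (f := fun t => ⟪f t, e i⟫) hT ?_ (continuousOn_const.inner hv) ?_ ?_
    · exact ⟨hf.1.inner_const (e i), hf.2.inner_const (e i)⟩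
    · intro t ht
      exact (innerSL ℝ (e i)).hasFDerivAt.comp_hasDerivWithinAt t (hu t ht)
    · intro t ht
      obtain ⟨hm, hem⟩ := (he i).2
      have h := heq ⟨e i, hm⟩ t ht
      rw [hem] at h
      simp only [real_inner_smul_right] at h
      simp only [real_inner_comm (e i)] at h ⊢
      exact h
  have h1 := (hsum T).sub (hsum 0)
  simp only [hcoord] at h1
  refine h1.unique ?_
  exact (hasSum_integral_inner_mul_inner e hf (by rwa [uIcc_of_le hT])).mul_left 2

end EnergyIdentity

/-! ### Chain rule for the potential along a trajectory -/

section Potential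

open Filter Topology

universe u

variable {H : Type u} [NormedAddCommGroup H] [InnerProductSpace ℝ H] [CompleteSpace H]
  {A : H →ₗ.[ℝ] H} {ψ : EnergyDom A → ℝ} {gradψ : EnergyDom A → H}

theorem IsPotential.hasDerivAt_segment (hψ : IsPotential A ψ gradψ) (x w : EnergyDom A) (θ : ℝ) :
    HasDerivAt (fun s : ℝ => ψ (x + s • w)) ⟪gradψ (x + θ • w), (w : H)⟫ θ := by
  -- A line derivative is a derivative at `0`; writing `0` as `θ - θ` prepares the shift.
  have h : HasDerivAt (fun s : ℝ => ψ (x + θ • w + s • w)) ⟪gradψ (x + θ • w), (w : H)⟫ (θ - θ) := by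
    rw [sub_self]; exact hψ.gateaux (x + θ • w) w
  have h2 := h.comp_sub_const θ θ
  refine h2.congr_of_eventuallyEq (Eventually.of_forall fun s => ?_)
  change ψ _ = ψ _
  congr 1
  module

/-- Mean value inequality on the segment, which stays in the convex ball of radius `r`. The bound
mixes one energy norm with one `H` norm, as the chain rule needs. -/
theorem IsPotential.abs_sub_sub_inner_le (hψ : IsPotential A ψ gradψ) {r L : ℝ} (hL0 : 0 ≤ L)
    (hL : ∀ u v : EnergyDom A, ‖sqrtOp A u‖ ≤ r → ‖sqrtOp A v‖ ≤ r →
      ‖gradψ u - gradψ v‖ ≤ L * ‖sqrtOp A (u - v)‖)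
    {x y : EnergyDom A} (hx : ‖sqrtOp A x‖ ≤ r) (hy : ‖sqrtOp A y‖ ≤ r) :
    |ψ y - ψ x - ⟪gradψ x, (y : H) - x⟫| ≤ L * ‖sqrtOp A (y - x)‖ * ‖(y : H) - x‖ := by
  have hd : ∀ θ ∈ Icc (0 : ℝ) 1,
      HasDerivWithinAt (fun s : ℝ => ψ (x + s • (y - x)) - s * ⟪gradψ x, (y : H) - x⟫)
        (⟪gradψ (x + θ • (y - x)), (y : H) - x⟫ - ⟪gradψ x, (y : H) - x⟫) (Icc 0 1) θ := by
    intro θ _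
    have h := (hψ.hasDerivAt_segment x (y - x) θ).sub
      ((hasDerivAt_id θ).mul_const ⟪gradψ x, (y : H) - x⟫)
    rw [one_mul] at h
    exact h.hasDerivWithinAt
  have hb : ∀ θ ∈ Ico (0 : ℝ) 1,
      ‖⟪gradψ (x + θ • (y - x)), (y : H) - x⟫ - ⟪gradψ x, (y : H) - x⟫‖ ≤
        L * ‖sqrtOp A (y - x)‖ * ‖(y : H) - x‖ := by
    intro θ hθ
    rw [← inner_sub_left]
    refine (norm_inner_le_norm _ _).trans (mul_le_mul_of_nonneg_right ?_ (norm_nonneg _))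
    have hz : ‖sqrtOp A (x + θ • (y - x))‖ ≤ r := by
      have he : sqrtOp A (x + θ • (y - x)) = (1 - θ) • sqrtOp A x + θ • sqrtOp A y := by
        rw [LinearPMap.map_add, LinearPMap.map_smul, LinearPMap.map_sub]
        module
      rw [he]
      refine (norm_add_le _ _).trans ?_
      rw [norm_smul, norm_smul, Real.norm_of_nonneg hθ.1,
        Real.norm_of_nonneg (sub_nonneg.2 hθ.2.le)]
      nlinarith [hθ.1, hθ.2]
    refine (hL _ _ hz hx).trans (mul_le_mul_of_nonneg_left ?_ hL0)
    rw [add_sub_cancel_left, LinearPMap.map_smul, norm_smul, Real.norm_of_nonneg hθ.1]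
    exact mul_le_of_le_one_left (norm_nonneg _) hθ.2.le
  have h := norm_image_sub_le_of_norm_deriv_le_segment' hd hb 1 (right_mem_Icc.2 zero_le_one)
  simp only [one_smul, zero_smul, add_zero, one_mul, zero_mul, sub_zero, mul_one,
    add_sub_cancel, Real.norm_eq_abs] at h
  rwa [sub_right_comm] at h

variable {u : ℝ → EnergyDom A} {s : Set ℝ}

theorem tendsto_sqrtOp_sub (hs : ContinuousOn (fun t => sqrtOp A (u t)) s) {t : ℝ} (ht : t ∈ s) :
    Tendsto (fun r => ‖sqrtOp A (u r - u t)‖) (𝓝[s] t) (𝓝 0) := by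
  have h := (hs t ht).tendsto.sub_const (sqrtOp A (u t))
  rw [sub_self] at h
  simpa only [LinearPMap.map_sub, norm_zero] using h.norm

theorem eventually_norm_sqrtOp_le (hs : ContinuousOn (fun t => sqrtOp A (u t)) s) {t : ℝ}
    (ht : t ∈ s) : ∀ᶠ r in 𝓝[s] t, ‖sqrtOp A (u r)‖ ≤ ‖sqrtOp A (u t)‖ + 1 :=
  (((hs t ht).tendsto.norm).eventually_lt_const (lt_add_one _)).mono fun _ h => h.le

theorem IsPotential.continuousOn_grad_comp (hψ : IsPotential A ψ gradψ)
    (hs : ContinuousOn (fun t => sqrtOp A (u t)) s) : ContinuousOn (fun t => gradψ (u t)) s := by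
  intro t ht
  obtain ⟨L, -, hL⟩ := hψ.locallyLipschitz (‖sqrtOp A (u t)‖ + 1) (by positivity)
  refine tendsto_iff_norm_sub_tendsto_zero.2 ?_
  have h := (tendsto_sqrtOp_sub hs ht).const_mul L
  rw [mul_zero] at h
  refine squeeze_zero' (Eventually.of_forall fun _ => norm_nonneg _) ?_ h
  filter_upwards [eventually_norm_sqrtOp_le hs ht] with r hr
  exact hL _ _ hr (by linarith)

/-- In the Taylor remainder the energy norm is `o(1)` by continuity in `D(A^{1/2})`, and the `H`
norm is `O(r - t)` by differentiability in `H`. -/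
theorem IsPotential.hasDerivWithinAt_comp (hψ : IsPotential A ψ gradψ)
    (hs : ContinuousOn (fun t => sqrtOp A (u t)) s) {t : ℝ} (ht : t ∈ s) {v : H}
    (hu : HasDerivWithinAt (fun r => (u r : H)) v s t) :
    HasDerivWithinAt (fun r => ψ (u r)) ⟪gradψ (u t), v⟫ s t := by
  obtain ⟨L, hL0, hL⟩ := hψ.locallyLipschitz (‖sqrtOp A (u t)‖ + 1) (by positivity)
  have hlin : HasDerivWithinAt (fun r => ⟪gradψ (u t), (u r : H)⟫) ⟪gradψ (u t), v⟫ s t :=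
    (innerSL ℝ (gradψ (u t))).hasFDerivAt.comp_hasDerivWithinAt t hu
  have hrem : HasDerivWithinAt (fun r => ψ (u r) - ⟪gradψ (u t), (u r : H)⟫) 0 s t := by
    rw [hasDerivWithinAt_iff_isLittleO]
    have h1 : (fun r => L * ‖sqrtOp A (u r - u t)‖) =o[𝓝[s] t] (fun _ => (1 : ℝ)) := by
      rw [Asymptotics.isLittleO_one_iff]
      simpa using (tendsto_sqrtOp_sub hs ht).const_mul L
    have h2 : (fun r => ‖(u r : H) - u t‖) =O[𝓝[s] t] fun r => r - t :=
      hu.hasFDerivWithinAt.isBigO_sub.norm_left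
    have h3 := h1.mul_isBigO h2
    simp only [one_mul] at h3
    refine Asymptotics.IsBigO.trans_isLittleO ?_ h3
    refine Asymptotics.IsBigO.of_bound 1 ?_
    filter_upwards [eventually_norm_sqrtOp_le hs ht] with r hr
    have h := hψ.abs_sub_sub_inner_le hL0.le hL (x := u t) (y := u r) (by linarith) hr
    rw [one_mul, Real.norm_eq_abs, Real.norm_of_nonneg (by positivity)]
    refine le_trans (le_of_eq ?_) h
    rw [inner_sub_right, smul_zero]
    congr 1; ring
  have h := hrem.add hlin
  rw [zero_add] at h
  exact h.congr_of_mem (fun r _ => by simp) ht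

end Potential

/-! ### Energy inequality for the delayed equation -/

section DelayEstimate

universe u

variable {H : Type u} [NormedAddCommGroup H] [InnerProductSpace ℝ H] [CompleteSpace H]
  {W₁ : Type*} [NormedAddCommGroup W₁] [InnerProductSpace ℝ W₁] [CompleteSpace W₁]
  {W₂ : Type*} [NormedAddCommGroup W₂] [InnerProductSpace ℝ W₂] [CompleteSpace W₂]
  {A : H →ₗ.[ℝ] H} {C : W₁ →L[ℝ] H} {B : W₂ →L[ℝ] H} {k τ : ℝ → ℝ} {τbar : ℝ}
  {ψ : EnergyDom A → ℝ} {gradψ : EnergyDom A → H} {u₀ : EnergyDom A} {u₁ : H} {g : ℝ → W₂}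
  {u : ℝ → EnergyDom A} {v : ℝ → H}

theorem observation_of_nonneg {s : ℝ} (hs : 0 ≤ s) : observation B g v s = B.adjoint (v s) :=
  if_neg (not_lt.2 hs)

theorem continuousOn_observation (hg : ContinuousOn g (Icc (-τbar) 0))
    (hv : ContinuousOn v (Ici 0)) (h0 : B.adjoint (v 0) = g 0) :
    ContinuousOn (observation B g v) (Ici (-τbar)) := by
  have h1 : ContinuousOn (observation B g v) (Icc (-τbar) 0) := by
    refine hg.congr fun s hs => ?_
    rcases hs.2.lt_or_eq with h | rfl
    · exact if_pos h
    · rw [observation_of_nonneg le_rfl, h0]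
  have h2 : ContinuousOn (observation B g v) (Ici 0) :=
    (B.adjoint.continuous.comp_continuousOn hv).congr fun s hs => observation_of_nonneg hs
  refine (h1.union_of_isClosed h2 isClosed_Icc isClosed_Ici).mono fun s hs => ?_
  rcases le_total s 0 with h | h
  · exact Or.inl ⟨hs, h⟩
  · exact Or.inr h

theorem intervalIntegrable_of_locallyIntegrableOn_Ici {f : ℝ → ℝ} {a b c : ℝ}
    (hf : LocallyIntegrableOn f (Ici c)) (ha : c ≤ a) (hb : c ≤ b) :
    IntervalIntegrable f volume a b :=
  intervalIntegrable_iff.2 <| (hf.integrableOn_compact_subset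
    (fun _ hx => (le_min ha hb).trans hx.1) isCompact_uIcc).mono_set uIoc_subset_uIcc

theorem IsSolution.continuousOn_potential (hψ : IsPotential A ψ gradψ)
    (hu : IsSolution A C B k τ gradψ u₀ u₁ g u v) : ContinuousOn (fun t => ψ (u t)) (Ici 0) :=
  fun t ht => (hψ.hasDerivWithinAt_comp hu.continuousOn_sqrt ht
    (hu.hasDeriv t ht)).continuousWithinAt

theorem IsSolution.integral_inner_grad (hψ : IsPotential A ψ gradψ)
    (hu : IsSolution A C B k τ gradψ u₀ u₁ g u v) {T : ℝ} (hT : 0 ≤ T) :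
    ∫ s in (0 : ℝ)..T, ⟪gradψ (u s), v s⟫ = ψ (u T) - ψ (u 0) := by
  refine intervalIntegral.integral_eq_sub_of_hasDerivAt_of_le hT
    ((hu.continuousOn_potential hψ).mono Icc_subset_Ici_self) (fun t ht => ?_) ?_
  · exact (hψ.hasDerivWithinAt_comp hu.continuousOn_sqrt ht.1.le
      (hu.hasDeriv t ht.1.le)).hasDerivAt (Ici_mem_nhds ht.1)
  · refine ContinuousOn.intervalIntegrable ?_
    rw [uIcc_of_le hT]
    exact ((hψ.continuousOn_grad_comp hu.continuousOn_sqrt).inner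
      hu.continuousOn_velocity).mono Icc_subset_Ici_self

/-- Integrated energy inequality for the delayed wave equation. -/
theorem IsSolution.energy_sub_le (hA : IsAdmissible A) (hτ_cont : ContinuousOn τ (Ici 0))
    (hτ : ∀ t : ℝ, 0 ≤ t → 0 ≤ τ t ∧ τ t ≤ τbar) (hk : LocallyIntegrableOn k (Ici (-τbar)))
    (hψ : IsPotential A ψ gradψ) (hg : ContinuousOn g (Icc (-τbar) 0))
    (hu : IsSolution A C B k τ gradψ u₀ u₁ g u v) {T : ℝ} (hT : 0 ≤ T) :
    energy A B k τbar ψ g u v T - energy A B k τbar ψ g u v 0 ≤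
      ∫ s in (0 : ℝ)..T, |k s| * (1 / 2 * ‖observation B g v (s - τ s)‖ ^ 2 +
        ‖observation B g v s‖ ^ 2) := by
  have hτ0 : 0 ≤ τbar := (hτ 0 le_rfl).1.trans (hτ 0 le_rfl).2
  set o := observation B g v with ho
  have hoc : ContinuousOn o (Ici (-τbar)) :=
    continuousOn_observation hg hu.continuousOn_velocity hu.history
  have hodc : ContinuousOn (fun s => o (s - τ s)) (Ici 0) :=
    hoc.comp (continuousOn_id.sub hτ_cont) fun s hs => by
      have := (hτ s hs).2
      have hs' : (0 : ℝ) ≤ s := hs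
      simp only [mem_Ici]; linarith
  have hvc := hu.continuousOn_velocity
  have hgc := hψ.continuousOn_grad_comp hu.continuousOn_sqrt
  have hsub : uIcc 0 T ⊆ Ici 0 := by rw [uIcc_of_le hT]; exact Icc_subset_Ici_self
  have hsub' : uIcc 0 T ⊆ Ici (-τbar) := hsub.trans (Ici_subset_Ici.2 (by linarith))
  have hkT : IntervalIntegrable k volume 0 T :=
    intervalIntegrable_of_locallyIntegrableOn_Ici hk (by linarith) (by linarith)
  -- Everything except `A u` is treated as forcing.
  let f : ℝ → H := fun s => gradψ (u s) - C (C.adjoint (v s)) - k s • B (o (s - τ s))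
  have hf : IntervalIntegrable f volume 0 T := by
    refine IntervalIntegrable.sub (ContinuousOn.intervalIntegrable ?_) ?_
    · exact (hgc.sub ((C.continuous.comp C.adjoint.continuous).comp_continuousOn hvc)).mono hsub
    · exact hkT.smul_continuousOn ((B.continuous.comp_continuousOn hodc).mono hsub)
  have hid := linear_energy_identity hA hT hf (hvc.mono Icc_subset_Ici_self)
    (fun t ht => (hu.hasDeriv t ht.1).mono Icc_subset_Ici_self) (u := u) (by
      intro w t ht
      rw [hu.equation w t ht.1, hu.initial_velocity]
      congr 2
      ext s
      simp only [f, inner_sub_left, real_inner_smul_left]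
      ring)
  have hgi : IntervalIntegrable (fun s => ⟪gradψ (u s), v s⟫) volume 0 T :=
    ((hgc.inner hvc).mono hsub).intervalIntegrable
  have hfi : IntervalIntegrable (fun s => ⟪f s, v s⟫) volume 0 T := by
    have h1 : IntervalIntegrable (fun s => ⟪gradψ (u s) - C (C.adjoint (v s)), v s⟫) volume 0 T :=
      (((hgc.sub ((C.continuous.comp C.adjoint.continuous).comp_continuousOn hvc)).inner
        hvc).mono hsub).intervalIntegrable
    have h2 : IntervalIntegrable (fun s => k s * ⟪B (o (s - τ s)), v s⟫) volume 0 T :=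
      hkT.mul_continuousOn (((B.continuous.comp_continuousOn hodc).inner hvc).mono hsub)
    refine (h1.sub h2).congr_ae (Filter.Eventually.of_forall fun s => ?_)
    simp only [f, inner_sub_left, real_inner_smul_left]
  have hki : ∀ a b : ℝ, -τbar ≤ a → -τbar ≤ b →
      IntervalIntegrable (fun s => |k s| * ‖o s‖ ^ 2) volume a b := fun a b ha hb =>
    (intervalIntegrable_of_locallyIntegrableOn_Ici hk ha hb).abs.mul_continuousOn
      ((hoc.norm.pow 2).mono fun x hx => (le_min ha hb).trans hx.1)
  have hdi : IntervalIntegrable (fun s => |k s| * (1 / 2 * ‖o (s - τ s)‖ ^ 2)) volume 0 T :=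
    hkT.abs.mul_continuousOn ((continuousOn_const.mul (hodc.norm.pow 2)).mono hsub)
  have hgrad := hu.integral_inner_grad hψ hT
  -- The window is enlarged to `[-τbar, T]`; the added integral is nonnegative.
  have hmem : ∫ s in (T - τbar)..T, |k s| * ‖o s‖ ^ 2 ≤
      (∫ s in (0 - τbar)..0, |k s| * ‖o s‖ ^ 2) + ∫ s in (0 : ℝ)..T, |k s| * ‖o s‖ ^ 2 := by
    have e1 := intervalIntegral.integral_add_adjacent_intervals
      (hki (0 - τbar) 0 (by linarith) (by linarith)) (hki 0 T (by linarith) (by linarith))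
    have e2 := intervalIntegral.integral_add_adjacent_intervals
      (hki (0 - τbar) (T - τbar) (by linarith) (by linarith))
      (hki (T - τbar) T (by linarith) (by linarith))
    have e3 : 0 ≤ ∫ s in (0 - τbar)..(T - τbar), |k s| * ‖o s‖ ^ 2 :=
      intervalIntegral.integral_nonneg (by linarith) fun s _ => by positivity
    linarith
  -- Damping contributes `-‖C* v‖² ≤ 0`, and Young splits the delay term into two halves. The memory
  -- integral later supplies the other half of `|k| ‖o(s)‖²`.
  have hdiss : (∫ s in (0 : ℝ)..T, ⟪f s, v s⟫) - ∫ s in (0 : ℝ)..T, ⟪gradψ (u s), v s⟫ ≤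
      ∫ s in (0 : ℝ)..T, (|k s| * (1 / 2 * ‖o (s - τ s)‖ ^ 2) + 1 / 2 * (|k s| * ‖o s‖ ^ 2)) := by
    rw [← intervalIntegral.integral_sub hfi hgi]
    refine intervalIntegral.integral_mono_on hT (hfi.sub hgi)
      (hdi.add ((hki 0 T (by linarith) (by linarith)).const_mul _)) fun s hs => ?_
    have e1 : ⟪C (C.adjoint (v s)), v s⟫ = ‖C.adjoint (v s)‖ ^ 2 := by
      rw [← ContinuousLinearMap.adjoint_inner_right, real_inner_self_eq_norm_sq]
    have e2 : ⟪B (o (s - τ s)), v s⟫ = ⟪o (s - τ s), o s⟫ := by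
      rw [← ContinuousLinearMap.adjoint_inner_right, ho, observation_of_nonneg hs.1]
    simp only [f, inner_sub_left, real_inner_smul_left, e1, e2]
    have h1 : -(k s * ⟪o (s - τ s), o s⟫) ≤ |k s| * (‖o (s - τ s)‖ * ‖o s‖) := by
      refine (neg_le_abs _).trans ?_
      rw [abs_mul]
      exact mul_le_mul_of_nonneg_left (abs_real_inner_le_norm _ _) (abs_nonneg _)
    have h2 : |k s| * (‖o (s - τ s)‖ * ‖o s‖) ≤
        |k s| * (1 / 2 * ‖o (s - τ s)‖ ^ 2 + 1 / 2 * ‖o s‖ ^ 2) :=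
      mul_le_mul_of_nonneg_left
        (by nlinarith [sq_nonneg (‖o (s - τ s)‖ - ‖o s‖)]) (abs_nonneg _)
    nlinarith [sq_nonneg ‖C.adjoint (v s)‖]
  have hsplit : ∫ s in (0 : ℝ)..T, |k s| * (1 / 2 * ‖o (s - τ s)‖ ^ 2 + ‖o s‖ ^ 2) =
      (∫ s in (0 : ℝ)..T, |k s| * (1 / 2 * ‖o (s - τ s)‖ ^ 2)) +
        ∫ s in (0 : ℝ)..T, |k s| * ‖o s‖ ^ 2 := by
    rw [← intervalIntegral.integral_add hdi (hki 0 T (by linarith) (by linarith))]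
    simp only [mul_add]
  rw [intervalIntegral.integral_add hdi ((hki 0 T (by linarith) (by linarith)).const_mul _),
    intervalIntegral.integral_const_mul] at hdiss
  rw [hsplit]
  unfold energy
  rw [← ho]
  linarith

theorem IsSolution.continuousOn_energy (hτ0 : 0 ≤ τbar)
    (hk : LocallyIntegrableOn k (Ici (-τbar))) (hψ : IsPotential A ψ gradψ)
    (hg : ContinuousOn g (Icc (-τbar) 0)) (hu : IsSolution A C B k τ gradψ u₀ u₁ g u v) {T : ℝ}
    (hT : 0 ≤ T) : ContinuousOn (energy A B k τbar ψ g u v) (Icc 0 T) := by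
  have hoc : ContinuousOn (observation B g v) (Ici (-τbar)) :=
    continuousOn_observation hg hu.continuousOn_velocity hu.history
  have hki : ∀ a b : ℝ, -τbar ≤ a → -τbar ≤ b →
      IntervalIntegrable (fun s => |k s| * ‖observation B g v s‖ ^ 2) volume a b := fun a b ha hb =>
    (intervalIntegrable_of_locallyIntegrableOn_Ici hk ha hb).abs.mul_continuousOn
      ((hoc.norm.pow 2).mono fun x hx => (le_min ha hb).trans hx.1)
  have hP : ContinuousOn (fun t => ∫ s in (-τbar)..t, |k s| * ‖observation B g v s‖ ^ 2)
      (Icc (-τbar) T) := by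
    have h := intervalIntegral.continuousOn_primitive_interval'
      (hki (-τbar) T le_rfl (by linarith)) left_mem_uIcc
    rwa [uIcc_of_le (by linarith)] at h
  -- The moving window is a difference of two values of one primitive based at `-τbar`.
  have hI : ContinuousOn (fun t => ∫ s in (t - τbar)..t, |k s| * ‖observation B g v s‖ ^ 2)
      (Icc 0 T) := by
    have h1 := hP.mono (Icc_subset_Icc_left (by linarith : -τbar ≤ 0))
    have h2 : ContinuousOn
        (fun t => ∫ s in (-τbar)..(t - τbar), |k s| * ‖observation B g v s‖ ^ 2) (Icc 0 T) :=
      hP.comp (f := fun t => t - τbar) (continuousOn_id.sub continuousOn_const)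
        fun t ht => ⟨by linarith [ht.1], by linarith [ht.2]⟩
    refine (h1.sub h2).congr fun t ht => ?_
    exact (intervalIntegral.integral_interval_sub_left
      (hki _ _ le_rfl (by linarith [ht.1])) (hki _ _ le_rfl (by linarith [ht.1]))).symm
  have hsub : Icc 0 T ⊆ Ici 0 := Icc_subset_Ici_self
  exact (((continuousOn_const.mul ((hu.continuousOn_velocity.mono hsub).norm.pow 2)).add
    (continuousOn_const.mul ((hu.continuousOn_sqrt.mono hsub).norm.pow 2))).sub
      ((hu.continuousOn_potential hψ).mono hsub)).add (continuousOn_const.mul hI)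

theorem IsSolution.sq_norm_observation_le (hE : ∀ t : ℝ, 0 ≤ t →
      1 / 4 * ‖v t‖ ^ 2 ≤ energy A B k τbar ψ g u v t) {s : ℝ} (hs : 0 ≤ s) :
    ‖observation B g v s‖ ^ 2 ≤ 4 * (‖B‖ ^ 2 * energy A B k τbar ψ g u v s) := by
  rw [observation_of_nonneg hs]
  have h1 : ‖B.adjoint (v s)‖ ≤ ‖B‖ * ‖v s‖ := by
    have h := B.adjoint.le_opNorm (v s)
    rwa [LinearIsometryEquiv.norm_map] at h
  have h2 : ‖B.adjoint (v s)‖ ^ 2 ≤ (‖B‖ * ‖v s‖) ^ 2 := by gcongr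
  rw [mul_pow] at h2
  nlinarith [mul_le_mul_of_nonneg_left (hE s hs) (sq_nonneg ‖B‖)]

theorem sq_norm_history_le (hg : ContinuousOn g (Icc (-τbar) 0)) {s : ℝ}
    (hs : s ∈ Icc (-τbar) 0) (t : ℝ) : ‖g s‖ ^ 2 ≤ 4 * energySup A B k τbar ψ g u v t := by
  have h1 : ‖g s‖ ^ 2 ≤ sSup ((fun s => ‖g s‖ ^ 2) '' Icc (-τbar) 0) :=
    le_csSup (isCompact_Icc.bddAbove_image (hg.norm.pow 2)) (mem_image_of_mem _ hs)
  have h2 := le_max_left (1 / 4 * sSup ((fun s => ‖g s‖ ^ 2) '' Icc (-τbar) 0))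
    (‖B‖ ^ 2 * sSup (energy A B k τbar ψ g u v '' Icc 0 t))
  unfold energySup
  linarith

theorem energy_zero_le_energySup :
    ‖B‖ ^ 2 * energy A B k τbar ψ g u v 0 ≤ energySup A B k τbar ψ g u v 0 := by
  unfold energySup
  rw [Icc_self, image_singleton, csSup_singleton]
  exact le_max_right _ _

theorem energySup_nonneg (t : ℝ) : 0 ≤ energySup A B k τbar ψ g u v t :=
  le_max_of_le_left (mul_nonneg (by norm_num)
    (Real.sSup_nonneg (by rintro _ ⟨s, -, rfl⟩; positivity)))

end DelayEstimate

end DelayWave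

/-! ### The exponential bound -/

theorem proposition2p1
    {H : Type*} [NormedAddCommGroup H] [InnerProductSpace ℝ H] [CompleteSpace H]
    {W₁ : Type*} [NormedAddCommGroup W₁] [InnerProductSpace ℝ W₁] [CompleteSpace W₁]
    {W₂ : Type*} [NormedAddCommGroup W₂] [InnerProductSpace ℝ W₂] [CompleteSpace W₂]
    (A : H →ₗ.[ℝ] H) (hA : DelayWave.IsAdmissible A)
    (C : W₁ →L[ℝ] H) (B : W₂ →L[ℝ] H) (hB : B ≠ 0)
    (τbar : ℝ) (τ : ℝ → ℝ) (hτ_cont : ContinuousOn τ (Ici 0))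
    (hτ : ∀ t : ℝ, 0 ≤ t → 0 ≤ τ t ∧ τ t ≤ τbar)
    (k : ℝ → ℝ) (hk : LocallyIntegrableOn k (Ici (-τbar)))
    (ψ : DelayWave.EnergyDom A → ℝ) (gradψ : DelayWave.EnergyDom A → H)
    (hψ : DelayWave.IsPotential A ψ gradψ)
    (u₀ : DelayWave.EnergyDom A) (u₁ : H) (g : ℝ → W₂) (hg : ContinuousOn g (Icc (-τbar) 0))
    (u : ℝ → DelayWave.EnergyDom A) (v : ℝ → H)
    (hu : DelayWave.IsSolution A C B k τ gradψ u₀ u₁ g u v)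
    (hE : ∀ t : ℝ, 0 ≤ t → 1 / 4 * ‖v t‖ ^ 2 ≤ DelayWave.energy A B k τbar ψ g u v t) :
    ∀ t : ℝ, 0 ≤ t →
      DelayWave.energy A B k τbar ψ g u v t ≤
        1 / ‖B‖ ^ 2 * Real.exp (6 * ‖B‖ ^ 2 * ∫ s in (0 : ℝ)..t, |k s|) *
          DelayWave.energySup A B k τbar ψ g u v 0 := by
  intro T hT
  set E := DelayWave.energy A B k τbar ψ g u v with hEdef
  set M := DelayWave.energySup A B k τbar ψ g u v 0 with hMdef
  have hτ0 : 0 ≤ τbar := (hτ 0 le_rfl).1.trans (hτ 0 le_rfl).2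
  have hb : 0 < ‖B‖ ^ 2 := pow_pos (norm_pos_iff.2 hB) 2
  have hki : ∀ a b : ℝ, 0 ≤ a → 0 ≤ b →
      IntervalIntegrable (fun s => 6 * ‖B‖ ^ 2 * |k s|) volume a b := fun a b ha hb =>
    (DelayWave.intervalIntegrable_of_locallyIntegrableOn_Ici hk (by linarith)
      (by linarith)).abs.const_mul _
  have hκ0 : ∀ s, 0 ≤ 6 * ‖B‖ ^ 2 * |k s| := fun s => by positivity
  have hKmono : ∀ r s : ℝ, 0 ≤ r → r ≤ s →
      (∫ x in (0 : ℝ)..r, 6 * ‖B‖ ^ 2 * |k x|) ≤ ∫ x in (0 : ℝ)..s, 6 * ‖B‖ ^ 2 * |k x| := by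
    intro r s hr hrs
    rw [← intervalIntegral.integral_add_adjacent_intervals (hki 0 r le_rfl hr)
      (hki r s hr (hr.trans hrs))]
    exact le_add_of_nonneg_right (intervalIntegral.integral_nonneg hrs fun x _ => hκ0 x)
  have hoc := DelayWave.continuousOn_observation hg hu.continuousOn_velocity hu.history
  have hmain := DelayWave.gronwall_of_continuation (y := fun t => ‖B‖ ^ 2 * E t) (M := M) hT
    (hki 0 T le_rfl hT) (continuousOn_const.mul (hu.continuousOn_energy hτ0 hk hψ hg hT))
    DelayWave.energy_zero_le_energySup ?_
  · rw [intervalIntegral.integral_const_mul] at hmain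
    rw [one_div, mul_assoc, le_inv_mul_iff₀ hb, mul_comm (Real.exp _)]
    exact hmain
  intro N hN t ht hle
  have hN0 : 0 ≤ N := (DelayWave.energySup_nonneg 0).trans hN
  have hE1 := hu.energy_sub_le hA hτ_cont hτ hk hψ hg ht.1
  rw [← mul_sub]
  refine (mul_le_mul_of_nonneg_left hE1 hb.le).trans ?_
  rw [← intervalIntegral.integral_const_mul]
  have hsub : uIcc 0 t ⊆ Ici 0 := by rw [uIcc_of_le ht.1]; exact Icc_subset_Ici_self
  have hodc : ContinuousOn (fun s => DelayWave.observation B g v (s - τ s)) (Ici 0) :=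
    hoc.comp (continuousOn_id.sub hτ_cont) fun s hs => by
      have hs' : (0 : ℝ) ≤ s := hs
      have := (hτ s hs').2
      simp only [mem_Ici]; linarith
  have hoc0 := hoc.mono (Ici_subset_Ici.2 (by linarith : -τbar ≤ 0))
  refine intervalIntegral.integral_mono_on ht.1 ?_ ?_ fun s hs => ?_
  · refine IntervalIntegrable.const_mul ?_ _
    exact (DelayWave.intervalIntegrable_of_locallyIntegrableOn_Ici hk (by linarith)
      (by linarith [ht.1])).abs.mul_continuousOn
        (((continuousOn_const.mul (hodc.norm.pow 2)).add (hoc0.norm.pow 2)).mono hsub)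
  · refine (hki 0 t le_rfl ht.1).mul_continuousOn (continuousOn_const.mul
      (Real.continuous_exp.comp_continuousOn ?_))
    exact intervalIntegral.continuousOn_primitive_interval' (hki 0 t le_rfl ht.1) left_mem_uIcc
  -- Monotonicity of the exponent lets the bound at `s` serve all earlier times.
  have hobs : ∀ r ∈ Icc 0 s, ‖DelayWave.observation B g v r‖ ^ 2 ≤
      4 * (N * Real.exp (∫ x in (0 : ℝ)..s, 6 * ‖B‖ ^ 2 * |k x|)) := by
    intro r hr
    refine (DelayWave.IsSolution.sq_norm_observation_le hE hr.1).trans ?_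
    have h1 := hle r ⟨hr.1, hr.2.trans hs.2⟩
    have h2 := mul_le_mul_of_nonneg_left (Real.exp_le_exp.2 (hKmono r s hr.1 hr.2)) hN0
    linarith
  have hdelay : ‖DelayWave.observation B g v (s - τ s)‖ ^ 2 ≤
      4 * (N * Real.exp (∫ x in (0 : ℝ)..s, 6 * ‖B‖ ^ 2 * |k x|)) := by
    have hτs := hτ s hs.1
    -- A negative delayed time falls in the history, where `¼‖g‖² ≤ M ≤ N` and the exponential is at
    -- least `1`.
    rcases lt_or_ge (s - τ s) 0 with h | h
    · rw [DelayWave.observation, if_pos h]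
      have h1 := DelayWave.sq_norm_history_le (A := A) (B := B) (k := k) (ψ := ψ) (u := u) (v := v)
        hg (s := s - τ s) ⟨by linarith [hs.1], h.le⟩ 0
      have h2 : 1 ≤ Real.exp (∫ x in (0 : ℝ)..s, 6 * ‖B‖ ^ 2 * |k x|) :=
        Real.one_le_exp (intervalIntegral.integral_nonneg hs.1 fun x _ => hκ0 x)
      have h3 := le_mul_of_one_le_right hN0 h2
      linarith
    · exact hobs _ ⟨h, by linarith⟩
  have h0 := hobs s ⟨hs.1, le_rfl⟩
  set P := N * Real.exp (∫ x in (0 : ℝ)..s, 6 * ‖B‖ ^ 2 * |k x|)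
  calc ‖B‖ ^ 2 * (|k s| * (1 / 2 * ‖DelayWave.observation B g v (s - τ s)‖ ^ 2 +
        ‖DelayWave.observation B g v s‖ ^ 2))
      -- Both observations are at most `4 P`, and `½·4 + 4 = 6`.
      ≤ ‖B‖ ^ 2 * (|k s| * (6 * P)) := by gcongr; linarith
    _ = 6 * ‖B‖ ^ 2 * |k s| * P := by ring
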